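/- Let $X$ and $Y$ be separable real Hilbert spaces, let $\mathcal N\subset\mathbb N$, let $(e_k)_{k\in\mathcal N}$ be an orthonormal basis of $X$, and write $x_k=\langle x,e_k\rangle$. Let $\mathcal I=(I_k)_{k\in\mathcal N}$ be a family of bounded closed intervals of $\mathbb R$ such that for every $k\in\mathcal N$ there is $\omega>0$ with $[-\omega,\omega]\subset I_k$. Let $A\colon X\to Y$ be a bounded linear operator, let $y\in Y$, and define $f\colon X\to\mathbb R\cup\{+\infty\}$ by $$f(x)=\|x\|_{1,\mathcal I}+\tfrac12\|Ax-y\|_Y^2,\qquad \|x\|_{1,\mathcal I}=\sum_{k\in\mathcal N}\sigma_{I_k}(x_k),\qquad \sigma_{I_k}(t)=\sup_{s\in I_k}st .$$ Then $f$ has the finite uniform conditioning property of order $2$. That is, $f$ is proper, convex and lower semicontinuous, and for every finite $J\subset\mathcal N$, every $\bar x\in\operatorname{argmin} f$ and all $\delta,r\in\,]0,+\infty[$ there exists $\gamma>0$ such that $$\frac{\gamma}{2}\,\operatorname{dist}(x,\operatorname{argmin} f)^2\le f(x)-\inf f$$ for every $x\in X$ with $x_k=0$ for all $k\in\mathcal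 N\setminus J$, $\|x-\bar x\|\le\delta$ and $f(x)-\inf f<r$. -/

import Mathlib

open scoped ENNReal

noncomputable section

/-- The support function `σ_I(t) = sup_{s ∈ I} s t` of a set `I ⊆ ℝ`, with values in `[-∞, +∞]`. -/
def supportFunction (I : Set ℝ) (t : ℝ) : EReal :=
  ⨆ s ∈ I, ((s * t : ℝ) : EReal)

/-- `φ ∈ Γ₀(X)`: the function `φ : X → ℝ ∪ {+∞}` is proper, convex (its epigraph is convex)
and lower semicontinuous. -/
structure IsGammaZero {X : Type*} [NormedAddCommGroup X] [NormedSpace ℝ X]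
    (φ : X → EReal) : Prop where
  ne_bot : ∀ x, φ x ≠ ⊥
  exists_ne_top : ∃ x, φ x ≠ ⊤
  convex_epigraph : Convex ℝ {q : X × ℝ | φ q.1 ≤ (q.2 : EReal)}
  lowerSemicontinuous : LowerSemicontinuous φ

/-- The set of global minimizers of `φ`. -/
def argminSet {X : Type*} (φ : X → EReal) : Set X :=
  {x | ∀ z, φ x ≤ φ z}

/-- The sublevel set `S_φ(r) = {x | φ x - inf φ < r}`. -/
def sublevelSet {X : Type*} (φ : X → EReal) (r : ℝ) : Set X :=
  {x | φ x - ⨅ z, φ z < (r : EReal)}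

/-- `φ` is `p`-conditioned on `Ω` (for `φ ∈ Γ₀(X)` and `2 ≤ p < ∞`): there is `γ > 0` with
`(γ / p) dist(x, argmin φ) ^ p ≤ φ x - inf φ` for all `x ∈ Ω`.
The distance is extended-valued, so that `dist(x, ∅) = +∞`. -/
def IsConditionedOn {X : Type*} [NormedAddCommGroup X] (p : ℝ) (φ : X → EReal)
    (Ω : Set X) : Prop :=
  ∃ γ : ℝ, 0 < γ ∧ ∀ x ∈ Ω,
    ((ENNReal.ofReal (γ / p) * Metric.infEDist x (argminSet φ) ^ p : ℝ≥0∞) : EReal)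
      ≤ φ x - ⨅ z, φ z

section Basis

variable {ι : Type*} {X : Type*} [NormedAddCommGroup X] [InnerProductSpace ℝ X]

/-- The support of `x` with respect to an orthonormal (Hilbert) basis. -/
def basisSupport (e : HilbertBasis ι ℝ X) (x : X) : Set ι :=
  {k | inner ℝ x (e k) ≠ 0}

/-- The subspace `X_J` of the vectors supported in `J`. -/
def supportedIn (e : HilbertBasis ι ℝ X) (J : Set ι) : Set X :=
  {x | basisSupport e x ⊆ J}

/-- The finite uniform conditioning property of order `p`, for `2 ≤ p < ∞`, of `φ ∈ Γ₀(X)`. -/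
def FiniteUniformConditioning (e : HilbertBasis ι ℝ X) (p : ℝ) (φ : X → EReal) : Prop :=
  IsGammaZero φ ∧
    ∀ J : Set ι, J.Finite → ∀ xbar ∈ argminSet φ, ∀ δ r : ℝ, 0 < δ → 0 < r →
      IsConditionedOn p φ (supportedIn e J ∩ Metric.closedBall xbar δ ∩ sublevelSet φ r)

/-- The weighted norm `‖x‖_{1,𝓘} = ∑ₖ σ_{Iₖ}(⟨x, eₖ⟩)`. When `0 ∈ Iₖ` for all `k`, the terms are
nonnegative and the unconditional sum always exists in `[0, +∞]`, see
`weightedL1_eq_iSup`. -/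
def weightedL1 (e : HilbertBasis ι ℝ X) (I : ι → Set ℝ) (x : X) : EReal :=
  ∑' k, supportFunction (I k) (inner ℝ x (e k))

theorem supportFunction_nonneg {I : Set ℝ} (h : (0 : ℝ) ∈ I) (t : ℝ) :
    0 ≤ supportFunction I t := by
  refine le_trans (by simp) (le_iSup₂ (f := fun s (_ : s ∈ I) => ((s * t : ℝ) : EReal)) 0 h)

/-- The series defining `‖x‖_{1,𝓘}` is the supremum of its finite partial sums. -/
theorem weightedL1_eq_iSup (e : HilbertBasis ι ℝ X) (I : ι → Set ℝ) (h : ∀ k, (0 : ℝ) ∈ I k)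
    (x : X) :
    weightedL1 e I x = ⨆ F : Finset ι, ∑ k ∈ F, supportFunction (I k) (inner ℝ x (e k)) := by
  refine HasSum.tsum_eq ?_
  exact tendsto_atTop_iSup fun F G hFG =>
    Finset.sum_le_sum_of_subset_of_nonneg hFG fun k _ _ => supportFunction_nonneg (h k) _

/-- The regularized least squares objective `f(x) = ‖x‖_{1,𝓘} + ½ ‖A x - y‖²`. -/
def l1LeastSquares {Y : Type*} [NormedAddCommGroup Y] [InnerProductSpace ℝ Y]
    (e : HilbertBasis ι ℝ X) (I : ι → Set ℝ) (A : X →L[ℝ] Y) (y : Y) (x : X) : EReal :=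
  weightedL1 e I x + ((1 / 2 * ‖A x - y‖ ^ 2 : ℝ) : EReal)

end Basis

end

/-!
Restricted to the vectors supported in a finite set `J`, the objective `f` is a function on a
Euclidean space, and it splits there as a separable piecewise linear part `h` plus a convex
quadratic. Two cases occur.

If no minimizer of `f` is supported in `J`, then `f - inf f` is continuous and positive on the
compact set of vectors supported in `J` at distance at most `δ` from `xbar`, hence bounded below
there by a positive constant, while `dist(x, argmin f) ≤ ‖x - xbar‖ ≤ δ`. This case does occur: the
intervals may shrink along the basis, so minimizers need not be finitely supported.

If some minimizer `x₀` is supported in `J`, first-order optimality (`linearized_le_of_forall_le`)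
lets one write `f(x) - f(x₀) = D(x) + ½ ‖A (x - x₀)‖²`, where `D` is `h` tilted by the gradient of
the quadratic part at `x₀`. As `h` is positively homogeneous and separable, `D` is a sum of terms
`max (ℓ x) 0` with `ℓ` linear. The minimizers supported in `J` thus form the polyhedron
`{A s = A x₀, ℓ s ≤ 0}`, and Hoffman's bound (`exists_polyhedron_error_bound`) gives
`dist(x, argmin f) ≤ C (‖A (x - x₀)‖ + D(x))`. On a sublevel set `D` is bounded, so `D² ≤ r D`, and
squaring yields quadratic growth (`euclideanObjective_growth`).

Hoffman's bound is proved by compactness: if `s` is the projection of `x` on the polyhedron, the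
direction of `x - s` lies in the polar of the cone of feasible directions at `s`, which depends only
on the set of constraints active at `s`. The residual restricted to the active constraints is
positive on the unit vectors of that polar, and there are finitely many active sets.
-/

/-! ### Error bounds for polyhedra -/

/-- Hoffman's error bound: the distance of `x` to the nonempty polyhedron
`{s | B s = B x₀ ∧ ∀ i, ℓ i s ≤ b i}` is at most a constant times the violation of the constraints
at `x`. -/
theorem exists_polyhedron_error_bound {E F κ : Type*} [NormedAddCommGroup E]
    [InnerProductSpace ℝ E] [FiniteDimensional ℝ E] [NormedAddCommGroup F] [NormedSpace ℝ F]
    [Fintype κ] (B : E →L[ℝ] F) (ℓ : κ → E →L[ℝ] ℝ) (b : κ → ℝ) (x₀ : E)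
    (hx₀ : ∀ i, ℓ i x₀ ≤ b i) :
    ∃ C : ℝ, 0 < C ∧ ∀ x, ∃ s, B s = B x₀ ∧ (∀ i, ℓ i s ≤ b i) ∧
      ‖x - s‖ ≤ C * (‖B (x - x₀)‖ + ∑ i, max (ℓ i x - b i) 0) := by
  classical
  -- `K` stands for the set of active constraints; the condition on `u` is membership in the polar of
  -- the cone of feasible directions
  have key : ∀ K : Finset κ, ∃ c : ℝ, 0 < c ∧ ∀ u : E, ‖u‖ = 1 →
      (∀ v : E, B v = 0 → (∀ i ∈ K, ℓ i v ≤ 0) → inner ℝ u v ≤ 0) →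
      c ≤ ‖B u‖ + ∑ i ∈ K, max (ℓ i u) 0 := by
    intro K
    set N : Set E := {u | ‖u‖ = 1 ∧
      ∀ v : E, B v = 0 → (∀ i ∈ K, ℓ i v ≤ 0) → inner ℝ u v ≤ 0} with hN
    have hNc : IsCompact N := by
      have hcl : IsClosed {u : E | ∀ v : E, B v = 0 → (∀ i ∈ K, ℓ i v ≤ 0) →
          inner ℝ u v ≤ 0} := by
        simp only [Set.ofPred_forall]
        refine isClosed_iInter fun v => isClosed_iInter fun _ => isClosed_iInter fun _ => ?_
        exact isClosed_le (by fun_prop) continuous_const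
      have : N = Metric.sphere 0 1 ∩ {u : E | ∀ v : E, B v = 0 → (∀ i ∈ K, ℓ i v ≤ 0) →
          inner ℝ u v ≤ 0} := by
        ext u
        simp [hN]
      rw [this]
      exact (isCompact_sphere 0 1).inter_right hcl
    rcases N.eq_empty_or_nonempty with hE | hne
    · exact ⟨1, one_pos, fun u hu hv => (hE.subset (show u ∈ N from ⟨hu, hv⟩)).elim⟩
    obtain ⟨u₀, hu₀, hmin⟩ := hNc.exists_isMinOn hne
      (f := fun u => ‖B u‖ + ∑ i ∈ K, max (ℓ i u) 0) (by fun_prop)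
    refine ⟨_, ?_, fun u hu hv => hmin (show u ∈ N from ⟨hu, hv⟩)⟩
    have hsum : 0 ≤ ∑ i ∈ K, max (ℓ i u₀) 0 := Finset.sum_nonneg fun _ _ => le_max_right _ _
    refine lt_of_le_of_ne (by positivity) fun h0 => ?_
    -- a zero of the residual lies in the cone, hence is orthogonal to itself
    have hB : ‖B u₀‖ = 0 := by linarith [norm_nonneg (B u₀)]
    have hs : ∑ i ∈ K, max (ℓ i u₀) 0 = 0 := by linarith [norm_nonneg (B u₀)]
    rw [Finset.sum_eq_zero_iff_of_nonneg fun _ _ => le_max_right _ _] at hs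
    have h := hu₀.2 u₀ (norm_eq_zero.1 hB) fun i hi => by
      have := le_max_left (ℓ i u₀) 0
      rwa [hs i hi] at this
    rw [real_inner_self_eq_norm_sq, hu₀.1] at h
    norm_num at h
  choose c hc0 hc using key
  obtain ⟨K₀, hK₀⟩ := Finite.exists_min c
  refine ⟨(c K₀)⁻¹, inv_pos.2 (hc0 _), fun x => ?_⟩
  set S : Set E := {s | B s = B x₀ ∧ ∀ i, ℓ i s ≤ b i} with hS
  have hScl : IsClosed S := by
    have : S = {s | B s = B x₀} ∩ ⋂ i, {s | ℓ i s ≤ b i} := by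
      ext
      simp [hS]
    rw [this]
    exact (isClosed_eq B.continuous continuous_const).inter
      (isClosed_iInter fun i => isClosed_le (ℓ i).continuous continuous_const)
  have hSconv : Convex ℝ S := by
    intro p hp q hq α β hα hβ hαβ
    refine ⟨?_, fun i => ?_⟩
    · rw [map_add, map_smul, map_smul, hp.1, hq.1, ← add_smul, hαβ, one_smul]
    · have h1 := mul_le_mul_of_nonneg_left (hp.2 i) hα
      have h2 := mul_le_mul_of_nonneg_left (hq.2 i) hβ
      have h3 : α * b i + β * b i = b i := by rw [← add_mul, hαβ, one_mul]
      simp only [map_add, map_smul, smul_eq_mul]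
      linarith
  obtain ⟨s, hs, hproj⟩ := exists_norm_eq_iInf_of_complete_convex
    (show S.Nonempty from ⟨x₀, rfl, hx₀⟩)
    hScl.isComplete hSconv x
  rw [norm_eq_iInf_iff_real_inner_le_zero hSconv hs] at hproj
  refine ⟨s, hs.1, hs.2, ?_⟩
  have hres : ∀ K : Finset κ, 0 ≤ ∑ i ∈ K, max (ℓ i x - b i) 0 :=
    fun K => Finset.sum_nonneg fun _ _ => le_max_right _ _
  rcases (norm_nonneg (x - s)).eq_or_lt with h0 | hpos
  · rw [← h0]
    have := hres Finset.univ
    have := hc0 K₀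
    positivity
  set d := ‖x - s‖ with hd
  let K : Finset κ := Finset.univ.filter fun i => ℓ i s = b i
  have hcone : ∀ v : E, B v = 0 → (∀ i ∈ K, ℓ i v ≤ 0) →
      inner ℝ (d⁻¹ • (x - s)) v ≤ 0 := by
    intro v hBv hv
    -- a short step from `s` along `v` stays in the polyhedron: inactive constraints have slack
    have hev : ∀ᶠ ε : ℝ in nhdsWithin 0 (Set.Ioi 0), ∀ i, ℓ i (s + ε • v) ≤ b i := by
      refine Filter.eventually_all.2 fun i => ?_
      by_cases hi : ℓ i s = b i
      · filter_upwards [self_mem_nhdsWithin] with ε hε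
        have := mul_nonpos_of_nonneg_of_nonpos (le_of_lt hε) (hv i (by simp [K, hi]))
        simp only [map_add, map_smul, smul_eq_mul]
        linarith
      · have hlt : ℓ i s < b i := lt_of_le_of_ne (hs.2 i) hi
        have hcont : Continuous fun ε : ℝ => ℓ i (s + ε • v) := by fun_prop
        have := hcont.tendsto 0
        simp only [zero_smul, add_zero] at this
        filter_upwards [nhdsWithin_le_nhds (this.eventually (gt_mem_nhds hlt))] with ε hε
        exact hε.le
    obtain ⟨ε, hε, hε0⟩ := (hev.and self_mem_nhdsWithin).exists
    have h := hproj (s + ε • v) ⟨by simp [hBv, hs.1], hε⟩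
    rw [add_sub_cancel_left, real_inner_smul_right] at h
    have h' : inner ℝ (x - s) v ≤ 0 := nonpos_of_mul_nonpos_right h hε0
    rw [real_inner_smul_left]
    exact mul_nonpos_of_nonneg_of_nonpos (inv_nonneg.2 hpos.le) h'
  have hmain := hc K (d⁻¹ • (x - s)) (by
    rw [norm_smul, norm_inv, Real.norm_of_nonneg hpos.le, ← hd, inv_mul_cancel₀ hpos.ne']) hcone
  have h1 : ‖B (d⁻¹ • (x - s))‖ = d⁻¹ * ‖B (x - x₀)‖ := by
    rw [map_smul, norm_smul, norm_inv, Real.norm_of_nonneg hpos.le, map_sub, map_sub, hs.1]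
  have h2 : ∑ i ∈ K, max (ℓ i (d⁻¹ • (x - s))) 0
      = d⁻¹ * ∑ i ∈ K, max (ℓ i x - b i) 0 := by
    rw [Finset.mul_sum]
    refine Finset.sum_congr rfl fun i hi => ?_
    have hi' : ℓ i s = b i := by simpa [K] using hi
    rw [mul_max_of_nonneg _ _ (inv_nonneg.2 hpos.le), mul_zero, map_smul, map_sub, hi',
      smul_eq_mul]
  have h3 : ∑ i ∈ K, max (ℓ i x - b i) 0 ≤ ∑ i, max (ℓ i x - b i) 0 :=
    Finset.sum_le_sum_of_subset_of_nonneg (Finset.subset_univ _) fun _ _ _ => le_max_right _ _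
  rw [h1, h2, ← mul_add] at hmain
  have h4 : c K₀ ≤ d⁻¹ * (‖B (x - x₀)‖ + ∑ i, max (ℓ i x - b i) 0) :=
    (hK₀ K).trans (hmain.trans (by gcongr))
  rw [inv_mul_eq_div, le_div_iff₀ hpos] at h4
  rw [inv_mul_eq_div, le_div_iff₀ (hc0 K₀)]
  linarith

/-! ### Quadratic growth in finite dimension -/

/-- First-order optimality: if `x₀` minimizes `h + ½ ‖B · - y‖²` with `h` convex, then it minimizes
the function in which the quadratic term is replaced by its linearization at `x₀`. -/
theorem linearized_le_of_forall_le {E Y : Type*} [NormedAddCommGroup E] [NormedSpace ℝ E]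
    [NormedAddCommGroup Y] [InnerProductSpace ℝ Y] (B : E →L[ℝ] Y) (y : Y) {h : E → ℝ}
    (hh : ConvexOn ℝ Set.univ h) {x₀ : E}
    (hmin : ∀ z, h x₀ + 1 / 2 * ‖B x₀ - y‖ ^ 2 ≤ h z + 1 / 2 * ‖B z - y‖ ^ 2) (z : E) :
    h x₀ + inner ℝ (B x₀ - y) (B x₀) ≤ h z + inner ℝ (B x₀ - y) (B z) := by
  by_contra! hlt
  set q := ‖B (z - x₀)‖ ^ 2 with hq
  set D := h z - h x₀ + inner ℝ (B x₀ - y) (B (z - x₀)) with hD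
  have hDneg : D < 0 := by
    rw [hD, map_sub, inner_sub_right]
    linarith
  have hq0 : 0 ≤ q := by positivity
  have hτ : ∀ τ : ℝ, 0 < τ → τ ≤ 1 → 0 ≤ D + τ / 2 * q := by
    intro τ h0 h1
    have hc := hh.2 (Set.mem_univ x₀) (Set.mem_univ z) (sub_nonneg.2 h1) h0.le (by ring)
    have hm := hmin ((1 - τ) • x₀ + τ • z)
    have he : B ((1 - τ) • x₀ + τ • z) - y = (B x₀ - y) + τ • B (z - x₀) := by
      simp only [map_add, map_smul, map_sub]
      module
    rw [he, norm_add_sq_real, real_inner_smul_right, norm_smul, mul_pow, ← hq,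
      Real.norm_eq_abs, sq_abs] at hm
    simp only [smul_eq_mul] at hc
    have : 0 ≤ τ * (D + τ / 2 * q) := by
      rw [hD]
      nlinarith
    exact nonneg_of_mul_nonneg_right this h0
  have hpos : 0 < -D / (q + 1) := by
    apply div_pos <;> linarith
  have h := hτ (min 1 (-D / (q + 1))) (lt_min one_pos hpos) (min_le_left _ _)
  have h2 : min 1 (-D / (q + 1)) * q ≤ -D := by
    calc min 1 (-D / (q + 1)) * q ≤ -D / (q + 1) * (q + 1) := by
          gcongr
          · exact min_le_right _ _
          · linarith
      _ = -D := by field_simp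
  linarith

/-- The `ℓ¹`-regularized least squares function on a finite-dimensional Euclidean space, the support
function of `[a k, b k]` being written as a maximum of two linear functions. -/
noncomputable def euclideanObjective {κ Y : Type*} [Fintype κ] [NormedAddCommGroup Y]
    [InnerProductSpace ℝ Y]
    (a b : κ → ℝ) (B : EuclideanSpace ℝ κ →L[ℝ] Y) (y : Y) (z : EuclideanSpace ℝ κ) : ℝ :=
  ∑ k, max (a k * z k) (b k * z k) + 1 / 2 * ‖B z - y‖ ^ 2

theorem continuous_euclideanObjective {κ Y : Type*} [Fintype κ] [NormedAddCommGroup Y]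
    [InnerProductSpace ℝ Y] (a b : κ → ℝ) (B : EuclideanSpace ℝ κ →L[ℝ] Y) (y : Y) :
    Continuous (euclideanObjective a b B y) := by
  unfold euclideanObjective
  fun_prop

theorem convexOn_sum_max {E κ : Type*} [AddCommGroup E] [Module ℝ E] (F : Finset κ)
    (a b : κ → ℝ) (φ : κ → E →ₗ[ℝ] ℝ) :
    ConvexOn ℝ Set.univ fun x => ∑ k ∈ F, max (a k * φ k x) (b k * φ k x) := by
  classical
  have h : ∀ k, ConvexOn ℝ Set.univ fun x => max (a k * φ k x) (b k * φ k x) := fun k =>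
    ((a k • φ k).convexOn convex_univ).sup ((b k • φ k).convexOn convex_univ)
  induction F using Finset.induction_on with
  | empty => simpa using convexOn_const (0 : ℝ) convex_univ
  | insert k F hk ih =>
    simp only [Finset.sum_insert hk]
    exact (h k).add ih

/-- Quadratic growth of `euclideanObjective` away from its minimizers, on sublevel sets. -/
theorem euclideanObjective_growth {κ Y : Type*} [Fintype κ] [NormedAddCommGroup Y]
    [InnerProductSpace ℝ Y] (a b : κ → ℝ) (B : EuclideanSpace ℝ κ →L[ℝ] Y) (y : Y)
    {x₀ : EuclideanSpace ℝ κ}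
    (hmin : ∀ z, euclideanObjective a b B y x₀ ≤ euclideanObjective a b B y z)
    {r : ℝ} (hr : 0 < r) :
    ∃ c : ℝ, 0 < c ∧ ∀ x, euclideanObjective a b B y x - euclideanObjective a b B y x₀ ≤ r →
      ∃ s, euclideanObjective a b B y s = euclideanObjective a b B y x₀ ∧
        c * ‖x - s‖ ^ 2 ≤ euclideanObjective a b B y x - euclideanObjective a b B y x₀ := by
  classical
  set h : EuclideanSpace ℝ κ → ℝ := fun z => ∑ k, max (a k * z k) (b k * z k) with hh
  have hconv : ConvexOn ℝ Set.univ h :=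
    convexOn_sum_max Finset.univ a b fun k => (EuclideanSpace.proj k).toLinearMap
  have hopt := linearized_le_of_forall_le B y hconv hmin
  set w := B x₀ - y with hw
  -- `h` is positively homogeneous, so the linearized minimum value is `0`
  have hhom : ∀ t : ℝ, 0 ≤ t → ∀ z, h (t • z) = t * h z := by
    intro t ht z
    simp only [hh, Finset.mul_sum, PiLp.smul_apply, smul_eq_mul]
    refine Finset.sum_congr rfl fun k _ => ?_
    rw [mul_max_of_nonneg _ _ ht]
    congr 1 <;> ring
  have hzero : h x₀ + inner ℝ w (B x₀) = 0 := by
    have h0 := hopt ((0 : ℝ) • x₀)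
    have h2 := hopt ((2 : ℝ) • x₀)
    rw [hhom _ (by norm_num), map_smul, real_inner_smul_right] at h0 h2
    linarith
  -- testing optimality on multiples of the basis vectors gives the signs of the slopes of each
  -- tilted one-dimensional term
  set c : κ → ℝ := fun k => inner ℝ w (B (EuclideanSpace.single k 1)) with hcdef
  have hsingle : ∀ k (t : ℝ), 0 ≤ max (a k * t) (b k * t) + t * c k := by
    intro k t
    have h1 := hopt (t • EuclideanSpace.single k (1 : ℝ))
    have h3 : h (t • EuclideanSpace.single k (1 : ℝ)) = max (a k * t) (b k * t) := by
      simp only [hh]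
      rw [Finset.sum_eq_single k] <;> simp +contextual
    rw [hzero, map_smul, real_inner_smul_right, h3] at h1
    exact h1
  have hα : ∀ k, 0 ≤ max (a k) (b k) + c k := fun k => by simpa using hsingle k 1
  have hβ : ∀ k, 0 ≤ -min (a k) (b k) - c k := fun k => by
    have := hsingle k (-1)
    simp only [mul_neg, mul_one, neg_mul, one_mul, max_neg_neg] at this
    linarith
  have hlin : ∀ z, inner ℝ w (B z) = ∑ k, z k * c k := by
    intro z
    have hz : z = ∑ k, z k • EuclideanSpace.single k (1 : ℝ) := by
      ext j
      simp [Finset.sum_apply, Pi.single_apply]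
    conv_lhs => rw [hz]
    simp only [map_sum, map_smul, inner_sum, real_inner_smul_right, hcdef]
  let ℓ : κ ⊕ κ → EuclideanSpace ℝ κ →L[ℝ] ℝ := Sum.elim
    (fun k => (max (a k) (b k) + c k) • EuclideanSpace.proj k)
    (fun k => -((-min (a k) (b k) - c k) • EuclideanSpace.proj k))
  have hscalar : ∀ (k : κ) (t : ℝ), max (a k * t) (b k * t) + t * c k
      = max ((max (a k) (b k) + c k) * t) 0 + max (-((-min (a k) (b k) - c k) * t)) 0 := by
    intro k t
    rcases le_total 0 t with ht | ht
    · rw [max_eq_left (mul_nonneg (hα k) ht),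
        max_eq_right (neg_nonpos.2 (mul_nonneg (hβ k) ht)), add_mul, max_mul_of_nonneg _ _ ht]
      ring
    · rw [max_eq_right (mul_nonpos_of_nonneg_of_nonpos (hα k) ht),
        max_eq_left (neg_nonneg.2 (mul_nonpos_of_nonneg_of_nonpos (hβ k) ht))]
      have h5 : max (a k * t) (b k * t) = min (a k) (b k) * t := by
        rcases le_total (a k) (b k) with hab | hab
        · rw [min_eq_left hab, max_eq_left (mul_le_mul_of_nonpos_right hab ht)]
        · rw [min_eq_right hab, max_eq_right (mul_le_mul_of_nonpos_right hab ht)]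
      rw [h5]
      ring
  have hD : ∀ z, h z + inner ℝ w (B z) = ∑ i, max (ℓ i z - 0) 0 := by
    intro z
    rw [hlin, Fintype.sum_sum_type, hh, ← Finset.sum_add_distrib, ← Finset.sum_add_distrib]
    refine Finset.sum_congr rfl fun k _ => ?_
    simpa [ℓ] using hscalar k (z k)
  have hD0 : ∀ z, 0 ≤ ∑ i, max (ℓ i z - 0) 0 := fun z =>
    Finset.sum_nonneg fun _ _ => le_max_right _ _
  have hgap : ∀ z, euclideanObjective a b B y z - euclideanObjective a b B y x₀
      = ∑ i, max (ℓ i z - 0) 0 + 1 / 2 * ‖B (z - x₀)‖ ^ 2 := by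
    intro z
    have he : B z - y = w + B (z - x₀) := by
      rw [hw, map_sub]
      abel
    have e1 : euclideanObjective a b B y z = h z + 1 / 2 * ‖w + B (z - x₀)‖ ^ 2 := by
      rw [← he]
      rfl
    have e2 : euclideanObjective a b B y x₀ = h x₀ + 1 / 2 * ‖w‖ ^ 2 := rfl
    have e3 : inner ℝ w (B (z - x₀)) = inner ℝ w (B z) - inner ℝ w (B x₀) := by
      rw [map_sub, inner_sub_right]
    rw [← hD, e1, e2, norm_add_sq_real, e3]
    linarith
  have hfeas : ∀ i, ℓ i x₀ ≤ 0 := by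
    have h1 := hD x₀
    rw [hzero, eq_comm, Finset.sum_eq_zero_iff_of_nonneg fun _ _ => le_max_right _ _] at h1
    intro i
    simpa using h1 i (Finset.mem_univ i)
  obtain ⟨C, hC, hbound⟩ := exists_polyhedron_error_bound B ℓ (fun _ => 0) x₀ hfeas
  refine ⟨(2 * C ^ 2 * (2 + r))⁻¹, by positivity, fun x hx => ?_⟩
  obtain ⟨s, hBs, hℓs, hdist⟩ := hbound x
  refine ⟨s, ?_, ?_⟩
  · have h1 : ∑ i, max (ℓ i s - 0) 0 = 0 :=
      Finset.sum_eq_zero fun i _ => by simpa using hℓs i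
    have h2 := hgap s
    rw [h1, map_sub, hBs, sub_self, norm_zero] at h2
    linarith
  · rw [hgap] at hx ⊢
    set D := ∑ i, max (ℓ i x - 0) 0 with hDdef
    have hDn : 0 ≤ D := hD0 x
    set q := ‖B (x - x₀)‖ with hq
    rw [inv_mul_eq_div, div_le_iff₀ (by positivity)]
    have hDr : D ^ 2 ≤ r * D := by nlinarith [sq_nonneg q]
    calc ‖x - s‖ ^ 2 ≤ (C * (q + D)) ^ 2 := by gcongr
      _ ≤ C ^ 2 * (2 * (q ^ 2 + D ^ 2)) := by
        rw [mul_pow]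
        gcongr
        nlinarith [sq_nonneg (q - D)]
      _ ≤ C ^ 2 * (2 * ((2 + r) * (D + 1 / 2 * q ^ 2))) := by
        gcongr
        nlinarith [mul_nonneg hr.le (sq_nonneg q)]
      _ = (D + 1 / 2 * q ^ 2) * (2 * C ^ 2 * (2 + r)) := by ring

/-! ### The objective as a supremum of real-valued functions -/

theorem supportFunction_Icc {a b : ℝ} (hab : a ≤ b) (t : ℝ) :
    supportFunction (Set.Icc a b) t = ((max (a * t) (b * t) : ℝ) : EReal) := by
  unfold supportFunction
  refine le_antisymm (iSup₂_le fun s hs => EReal.coe_le_coe_iff.2 ?_) ?_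
  · rcases le_total 0 t with ht | ht
    · exact le_max_of_le_right (mul_le_mul_of_nonneg_right hs.2 ht)
    · exact le_max_of_le_left (mul_le_mul_of_nonpos_right hs.1 ht)
  · rcases max_choice (a * t) (b * t) with h | h <;> rw [h]
    · exact le_iSup₂ (f := fun s (_ : s ∈ Set.Icc a b) => ((s * t : ℝ) : EReal)) a
        (Set.left_mem_Icc.2 hab)
    · exact le_iSup₂ (f := fun s (_ : s ∈ Set.Icc a b) => ((s * t : ℝ) : EReal)) b
        (Set.right_mem_Icc.2 hab)

section Objective

variable {ι X Y : Type*} [NormedAddCommGroup X] [InnerProductSpace ℝ X]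
  [NormedAddCommGroup Y] [InnerProductSpace ℝ Y]

/-- The objective in which only the finitely many coordinates in `F` are penalized, the support
function of `[a k, b k]` being written as a maximum of two linear functions. -/
noncomputable def partialObjective (e : HilbertBasis ι ℝ X) (a b : ι → ℝ) (A : X →L[ℝ] Y) (y : Y)
    (F : Finset ι) (x : X) : ℝ :=
  ∑ k ∈ F, max (a k * inner ℝ x (e k)) (b k * inner ℝ x (e k)) + 1 / 2 * ‖A x - y‖ ^ 2

theorem EReal.coe_finset_sum {α : Type*} (F : Finset α) (f : α → ℝ) :
    ((∑ k ∈ F, f k : ℝ) : EReal) = ∑ k ∈ F, (f k : EReal) :=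
  map_sum (⟨⟨Real.toEReal, EReal.coe_zero⟩, EReal.coe_add⟩ : ℝ →+ EReal) f F

variable (e : HilbertBasis ι ℝ X) {a b : ι → ℝ} (A : X →L[ℝ] Y) (y : Y)

theorem l1LeastSquares_Icc_eq_iSup (h : ∀ k, (0 : ℝ) ∈ Set.Icc (a k) (b k)) (x : X) :
    l1LeastSquares e (fun k => Set.Icc (a k) (b k)) A y x
      = ⨆ F : Finset ι, (partialObjective e a b A y F x : EReal) := by
  refine eq_of_forall_ge_iff fun t => ?_
  unfold l1LeastSquares
  rw [weightedL1_eq_iSup e _ h, ← EReal.le_sub_iff_add_le (.inl (EReal.coe_ne_bot _))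
    (.inl (EReal.coe_ne_top _)), iSup_le_iff, iSup_le_iff]
  refine forall_congr' fun F => ?_
  rw [EReal.le_sub_iff_add_le (.inl (EReal.coe_ne_bot _)) (.inl (EReal.coe_ne_top _)),
    partialObjective, EReal.coe_add, EReal.coe_finset_sum]
  simp only [supportFunction_Icc ((h _).1.trans (h _).2)]

theorem l1LeastSquares_Icc_eq_of_support_subset (hab : ∀ k, a k ≤ b k) {F : Finset ι} {x : X}
    (hx : ∀ k ∉ F, inner ℝ x (e k) = 0) :
    l1LeastSquares e (fun k => Set.Icc (a k) (b k)) A y x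
      = (partialObjective e a b A y F x : EReal) := by
  unfold l1LeastSquares weightedL1 partialObjective
  rw [tsum_eq_sum (s := F), EReal.coe_add, EReal.coe_finset_sum]
  · simp only [supportFunction_Icc (hab _)]
  · intro k hk
    rw [supportFunction_Icc (hab k), hx k hk]
    simp

theorem convexOn_partialObjective (F : Finset ι) :
    ConvexOn ℝ Set.univ (partialObjective e a b A y F) := by
  have h1 := convexOn_sum_max F a b fun k => (innerₛₗ ℝ (e k) : X →ₗ[ℝ] ℝ)
  have h2 : ConvexOn ℝ Set.univ fun x => ‖A x - y‖ := by
    simpa [dist_eq_norm, Function.comp_def] using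
      (convexOn_univ_dist y).comp_linearMap A.toLinearMap
  have h3 := (h2.pow (fun _ _ => norm_nonneg _) 2).smul (c := (1 / 2 : ℝ)) (by norm_num)
  refine (h1.add h3).congr fun x _ => ?_
  simp [partialObjective, real_inner_comm]

theorem isGammaZero_l1LeastSquares_Icc (h : ∀ k, (0 : ℝ) ∈ Set.Icc (a k) (b k)) :
    IsGammaZero (l1LeastSquares e (fun k => Set.Icc (a k) (b k)) A y) where
  ne_bot x := by
    rw [l1LeastSquares_Icc_eq_iSup e A y h]
    exact ne_bot_of_le_ne_bot (EReal.coe_ne_bot _)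
      (le_iSup (fun F : Finset ι => (partialObjective e a b A y F x : EReal)) ∅)
  exists_ne_top := by
    refine ⟨0, ?_⟩
    rw [l1LeastSquares_Icc_eq_of_support_subset e A y (fun k => (h k).1.trans (h k).2)
      (F := ∅) (by simp)]
    exact EReal.coe_ne_top _
  convex_epigraph := by
    have : {q : X × ℝ | l1LeastSquares e (fun k => Set.Icc (a k) (b k)) A y q.1 ≤ (q.2 : EReal)}
        = ⋂ F : Finset ι, {q : X × ℝ | q.1 ∈ Set.univ ∧ partialObjective e a b A y F q.1 ≤ q.2} := by
      ext q
      simp [l1LeastSquares_Icc_eq_iSup e A y h]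
    rw [this]
    exact convex_iInter fun F => (convexOn_partialObjective e A y F).convex_epigraph
  lowerSemicontinuous := by
    rw [funext (l1LeastSquares_Icc_eq_iSup e A y h)]
    refine lowerSemicontinuous_iSup fun F => Continuous.lowerSemicontinuous ?_
    refine continuous_coe_real_ereal.comp ?_
    unfold partialObjective
    fun_prop

/-! ### Finitely supported vectors -/

/-- The isometric embedding of a Euclidean space as the subspace of vectors supported in `F`. -/
noncomputable def finsetEmbedding (F : Finset ι) : EuclideanSpace ℝ F →ₗᵢ[ℝ] X where
  toFun z := ∑ k, z k • e k
  map_add' z w := by simp [add_smul, Finset.sum_add_distrib]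
  map_smul' c z := by simp [mul_smul, Finset.smul_sum]
  norm_map' z := by
    have h := (e.orthonormal.comp (Subtype.val : F → ι) Subtype.val_injective).inner_sum
      z z Finset.univ
    simp only [Function.comp_apply, conj_trivial] at h
    refine (sq_eq_sq₀ (norm_nonneg _) (norm_nonneg _)).1 ?_
    rw [EuclideanSpace.norm_sq_eq]
    simp only [Real.norm_eq_abs, sq_abs]
    rw [← real_inner_self_eq_norm_sq]
    simpa [pow_two] using h

theorem finsetEmbedding_apply (F : Finset ι) (z : EuclideanSpace ℝ F) :
    finsetEmbedding e F z = ∑ k, z k • e k := rfl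

theorem inner_finsetEmbedding_of_mem (F : Finset ι) (z : EuclideanSpace ℝ F) (k : F) :
    inner ℝ (finsetEmbedding e F z) (e k) = z k := by
  classical
  rw [finsetEmbedding_apply, sum_inner]
  simp only [real_inner_smul_left, orthonormal_iff_ite.1 e.orthonormal, Subtype.val_inj]
  simp

theorem inner_finsetEmbedding_of_notMem (F : Finset ι) (z : EuclideanSpace ℝ F) {k : ι}
    (hk : k ∉ F) : inner ℝ (finsetEmbedding e F z) (e k) = 0 := by
  classical
  rw [finsetEmbedding_apply, sum_inner]
  refine Finset.sum_eq_zero fun j _ => ?_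
  rw [real_inner_smul_left, orthonormal_iff_ite.1 e.orthonormal, if_neg, mul_zero]
  rintro rfl
  exact hk j.2

theorem exists_finsetEmbedding_eq {F : Finset ι} {x : X} (hx : ∀ k ∉ F, inner ℝ x (e k) = 0) :
    ∃ z, finsetEmbedding e F z = x := by
  refine ⟨WithLp.toLp 2 fun k => inner ℝ x (e k), e.repr.injective ?_⟩
  ext k
  rw [e.repr_apply_apply, e.repr_apply_apply, real_inner_comm, real_inner_comm x]
  by_cases hk : k ∈ F
  · exact inner_finsetEmbedding_of_mem e F _ ⟨k, hk⟩
  · rw [inner_finsetEmbedding_of_notMem e F _ hk, hx k hk]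

theorem partialObjective_finsetEmbedding (F : Finset ι) (z : EuclideanSpace ℝ F) :
    partialObjective e a b A y F (finsetEmbedding e F z)
      = euclideanObjective (fun k : F => a k) (fun k : F => b k)
          (A.comp (finsetEmbedding e F).toContinuousLinearMap) y z := by
  unfold partialObjective euclideanObjective
  rw [← Finset.sum_coe_sort F]
  simp only [inner_finsetEmbedding_of_mem]
  rfl

end Objective

/-! ### Conditioning -/

theorem iInf_eq_of_mem_argminSet {X : Type*} {φ : X → EReal} {x : X} (hx : x ∈ argminSet φ) :
    ⨅ z, φ z = φ x :=
  le_antisymm (iInf_le _ _) (le_iInf hx)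

/-- A minimizer `s` at controlled distance of `x` gives the conditioning inequality at `x`. -/
theorem conditioning_le_of_mem_argminSet {X : Type*} [NormedAddCommGroup X] {φ : X → EReal}
    {x s : X} {γ g m : ℝ} (hs : s ∈ argminSet φ) (hγ : 0 ≤ γ) (hx : φ x = g)
    (hm : ⨅ z, φ z = m) (h : γ / 2 * ‖x - s‖ ^ 2 ≤ g - m) :
    ((ENNReal.ofReal (γ / 2) * Metric.infEDist x (argminSet φ) ^ (2 : ℝ) : ℝ≥0∞) : EReal)
      ≤ φ x - ⨅ z, φ z := by
  have h1 : ENNReal.ofReal (γ / 2) * Metric.infEDist x (argminSet φ) ^ (2 : ℝ)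
      ≤ ENNReal.ofReal (γ / 2 * ‖x - s‖ ^ 2) := by
    rw [ENNReal.ofReal_mul (by positivity), ← Real.rpow_natCast, Nat.cast_ofNat,
      ← ENNReal.ofReal_rpow_of_nonneg (norm_nonneg _) (by norm_num), ← dist_eq_norm,
      ← edist_dist]
    gcongr
    exact Metric.infEDist_le_edist_of_mem hs
  refine (EReal.coe_ennreal_le_coe_ennreal_iff.2 h1).trans ?_
  rw [EReal.coe_ennreal_ofReal, max_eq_left (by positivity), hx, hm, ← EReal.coe_sub]
  exact EReal.coe_le_coe_iff.2 h

theorem isConditionedOn_l1LeastSquares_Icc {ι X Y : Type*} [NormedAddCommGroup X]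
    [InnerProductSpace ℝ X] [NormedAddCommGroup Y] [InnerProductSpace ℝ Y]
    (e : HilbertBasis ι ℝ X) {a b : ι → ℝ} (hab : ∀ k, (0 : ℝ) ∈ Set.Icc (a k) (b k))
    (A : X →L[ℝ] Y) (y : Y) {J : Set ι} (hJ : J.Finite) {xbar : X}
    (hbar : xbar ∈ argminSet (l1LeastSquares e (fun k => Set.Icc (a k) (b k)) A y))
    {δ r : ℝ} (hδ : 0 < δ) (hr : 0 < r) :
    IsConditionedOn 2 (l1LeastSquares e (fun k => Set.Icc (a k) (b k)) A y)
      (supportedIn e J ∩ Metric.closedBall xbar δ ∩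
        sublevelSet (l1LeastSquares e (fun k => Set.Icc (a k) (b k)) A y) r) := by
  set f := l1LeastSquares e (fun k => Set.Icc (a k) (b k)) A y with hf
  set F := hJ.toFinset with hF
  set T := finsetEmbedding e F with hT
  set g := euclideanObjective (fun k : F => a k) (fun k : F => b k)
    (A.comp T.toContinuousLinearMap) y with hg
  have hfT : ∀ z, f (T z) = (g z : EReal) := fun z => by
    rw [hf, l1LeastSquares_Icc_eq_of_support_subset e A y (fun k => (hab k).1.trans (hab k).2)
      (fun k hk => inner_finsetEmbedding_of_notMem e F z hk), partialObjective_finsetEmbedding]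
  have hrange : ∀ x ∈ supportedIn e J, ∃ z, T z = x := fun x hx =>
    exists_finsetEmbedding_eq e fun k hk => by
      by_contra hne
      exact hk (hJ.mem_toFinset.2 (hx hne))
  have hinf := iInf_eq_of_mem_argminSet hbar
  have hγ0 := isGammaZero_l1LeastSquares_Icc e A y hab
  obtain ⟨m, hm⟩ : ∃ m : ℝ, f xbar = m := by
    refine ⟨(f xbar).toReal, (EReal.coe_toReal ?_ (hγ0.ne_bot _)).symm⟩
    exact ne_top_of_le_ne_top (EReal.coe_ne_top (g 0)) ((hbar (T 0)).trans (hfT 0).le)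
  rw [hm] at hinf
  have hle : ∀ z, m ≤ g z := fun z => by
    rw [← EReal.coe_le_coe_iff, ← hm, ← hfT]
    exact hbar _
  by_cases hex : ∃ z₀, g z₀ = m
  · obtain ⟨z₀, hz₀⟩ := hex
    obtain ⟨c, hc, hgrowth⟩ := euclideanObjective_growth (fun k : F => a k) (fun k : F => b k)
      (A.comp T.toContinuousLinearMap) y (x₀ := z₀) (fun z => hz₀.trans_le (hle z)) hr
    rw [← hg, hz₀] at hgrowth
    refine ⟨2 * c, by positivity, ?_⟩
    rintro x ⟨⟨hxJ, -⟩, hxr⟩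
    obtain ⟨z, rfl⟩ := hrange x hxJ
    have hzr : g z - m ≤ r := by
      have : f (T z) - ⨅ z, f z < (r : EReal) := hxr
      rw [hfT, hinf, ← EReal.coe_sub, EReal.coe_lt_coe_iff] at this
      exact this.le
    obtain ⟨s, hs, hdist⟩ := hgrowth z hzr
    have hsarg : T s ∈ argminSet f := fun w => by
      rw [hfT, hs, ← hm]
      exact hbar w
    refine conditioning_le_of_mem_argminSet hsarg (by positivity) (hfT z) hinf ?_
    rw [← map_sub, T.norm_map, mul_div_cancel_left₀ _ two_ne_zero]
    exact hdist
  · -- no minimizer is supported in `J`: the gap is bounded below on the compact ball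
    push Not at hex
    set K : Set (EuclideanSpace ℝ F) := T ⁻¹' Metric.closedBall xbar δ with hK
    have hKc : IsCompact K := by
      refine Metric.isCompact_of_isClosed_isBounded
        (Metric.isClosed_closedBall.preimage T.continuous) ?_
      exact T.antilipschitz.isBounded_preimage Metric.isBounded_closedBall
    obtain ⟨c, hc, hgap⟩ : ∃ c : ℝ, 0 < c ∧ ∀ z ∈ K, c ≤ g z - m := by
      rcases K.eq_empty_or_nonempty with hE | hne
      · exact ⟨1, one_pos, fun z hz => (hE.subset hz).elim⟩
      obtain ⟨z₁, -, hz₁⟩ := hKc.exists_isMinOn hne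
        (continuous_euclideanObjective (fun k : F => a k) (fun k : F => b k)
          (A.comp T.toContinuousLinearMap) y).continuousOn
      exact ⟨g z₁ - m, sub_pos.2 (lt_of_le_of_ne (hle z₁) (hex z₁).symm),
        fun z hz => sub_le_sub_right (hz₁ hz) m⟩
    refine ⟨2 * (c / δ ^ 2), by positivity, ?_⟩
    rintro x ⟨⟨hxJ, hxδ⟩, -⟩
    obtain ⟨z, rfl⟩ := hrange x hxJ
    refine conditioning_le_of_mem_argminSet hbar (by positivity) (hfT z) hinf ?_
    rw [mul_div_cancel_left₀ _ two_ne_zero, ← dist_eq_norm]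
    calc c / δ ^ 2 * dist (T z) xbar ^ 2 ≤ c / δ ^ 2 * δ ^ 2 := by
          gcongr
          exact hxδ
      _ = c := by field_simp
      _ ≤ g z - m := hgap z hxδ

theorem proposition4p5
    {X : Type*} [NormedAddCommGroup X] [InnerProductSpace ℝ X] [CompleteSpace X]
    [TopologicalSpace.SeparableSpace X]
    {Y : Type*} [NormedAddCommGroup Y] [InnerProductSpace ℝ Y] [CompleteSpace Y]
    [TopologicalSpace.SeparableSpace Y]
    (N : Set ℕ) (e : HilbertBasis N ℝ X)
    (I : N → Set ℝ)
    (hI_interval : ∀ k, (I k).OrdConnected)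
    (hI_closed : ∀ k, IsClosed (I k))
    (hI_bounded : ∀ k, Bornology.IsBounded (I k))
    (hI_zero : ∀ k, ∃ ω : ℝ, 0 < ω ∧ Set.Icc (-ω) ω ⊆ I k)
    (A : X →L[ℝ] Y) (y : Y) :
    FiniteUniformConditioning e 2 (l1LeastSquares e I A y) := by
  have h0 : ∀ k, (0 : ℝ) ∈ I k := fun k => by
    obtain ⟨ω, hω, hsub⟩ := hI_zero k
    exact hsub ⟨by linarith, hω.le⟩
  have hIcc : ∀ k, ∃ a b : ℝ, I k = Set.Icc a b := fun k =>
    ⟨_, _, eq_Icc_of_connected_compact ⟨⟨0, h0 k⟩, (hI_interval k).isPreconnected⟩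
      (Metric.isCompact_of_isClosed_isBounded (hI_closed k) (hI_bounded k))⟩
  choose a b hab using hIcc
  obtain rfl : I = fun k => Set.Icc (a k) (b k) := funext hab
  exact ⟨isGammaZero_l1LeastSquares_Icc e A y h0, fun J hJ xbar hbar δ r hδ hr =>
    isConditionedOn_l1LeastSquares_Icc e h0 A y hJ hbar hδ hr⟩
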